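/- Let $p_1,p_2,s_1,s_2\in\mathbb R$ and consider the polar system $$\dot r=2rp_1+2r^2\bigl(s_1-\cos(12\theta)\bigr),\qquad \dot\theta=p_2+r\bigl(s_2+\sin(12\theta)\bigr),$$ as a vector field on the plane with $z=\sqrt r\,e^{i\theta}$, $r\ge 0$, that is, $\dot z=\bigl(\tfrac{\dot r}{2r}+i\dot\theta\bigr)z$ for $z\neq0$ and $\dot z=0$ at the origin $z=0$. Put $$\mathcal Q(p_1,p_2)=p_1^2+p_2^2-(p_1s_2-p_2s_1)^2=(1-s_2^2)p_1^2+(1-s_1^2)p_2^2+2s_1s_2p_1p_2 .$$ A critical point is called a saddle if its Jacobian has one negative and one positive eigenvalue. It is called a saddle-node if its Jacobian $J$ has a zero and a nonzero eigenvalue and $w\cdot D^2V(v,v)\ne0$, where $V$ is the vector field, $Jv=0$, $w^{T}J=0$, $v,w\neq0$. The index is the Poincaré index (the winding number of the field along small circles around the point). Suppose $s_2>1$. If $p_2\ge 0$, the origin is the only critical point. If $p_2<0$, then: 1. if $\mathcal Q(p_1,p_2)<0$, the origin is the only critical point; 2. if $\mathcal Q(p_1,p_2)=0$, there are exactly $13$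 critical points: the origin and twelve others, exactly one in each sector $\alpha\le\theta<\alpha+2\pi/12$ ($\alpha\in\mathbb R$). Each of the twelve has $0$ as an eigenvalue of its Jacobian and has index $0$, and each is a saddle-node if and only if $p_1^2s_1+6p_2^2s_1-5p_1p_2s_2\neq0$; 3. if $\mathcal Q(p_1,p_2)>0$, there are exactly $25$ critical points: the origin, twelve saddles and twelve points of index $+1$, with exactly one saddle and exactly one point of index $+1$ in each sector $\alpha\le\theta<\alpha+2\pi/12$ ($\alpha\in\mathbb R$). If $s_2<-1$, the same holds with $p_2\ge0$ replaced by $p_2\le0$ and $p_2<0$ replaced by $p_2>0$. -/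

import Mathlib

noncomputable section

/-- Right-hand side `ṙ` of the polar system. -/
def polarR (p₁ s₁ r θ : ℝ) : ℝ :=
  2 * r * p₁ + 2 * r ^ 2 * (s₁ - Real.cos (12 * θ))

/-- Right-hand side `θ̇` of the polar system. -/
def polarTheta (p₂ s₂ r θ : ℝ) : ℝ :=
  p₂ + r * (s₂ + Real.sin (12 * θ))

/-- The polar system as a vector field on its phase plane `ℂ`, where `z = √r e^{iθ}`.
Differentiating `z = √r e^{iθ}` gives `ż = (ṙ / (2 r) + i θ̇) z`, with `r = |z|²` and `θ = arg z`;
the value at `z = 0` is `0`, which is also the limit there. -/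
def planarField (p₁ p₂ s₁ s₂ : ℝ) (z : ℂ) : ℂ :=
  (((polarR p₁ s₁ (‖z‖ ^ 2) z.arg / (2 * ‖z‖ ^ 2) : ℝ) : ℂ) +
    ((polarTheta p₂ s₂ (‖z‖ ^ 2) z.arg : ℝ) : ℂ) * Complex.I) * z

/-- The critical points of the polar system in its phase plane. -/
def criticalPoints (p₁ p₂ s₁ s₂ : ℝ) : Set ℂ :=
  {z | planarField p₁ p₂ s₁ s₂ z = 0}

/-- The quadratic form `Q`. -/
def quadForm (s₁ s₂ p₁ p₂ : ℝ) : ℝ :=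
  p₁ ^ 2 + p₂ ^ 2 - (p₁ * s₂ - p₂ * s₁) ^ 2

/-- The sector `α ≤ θ < α + 2π/12`, which is one twelfth of the punctured phase plane. -/
def sector (α : ℝ) : Set ℂ :=
  {z | ∃ ρ θ : ℝ, 0 < ρ ∧ α ≤ θ ∧ θ < α + 2 * Real.pi / 12 ∧
    z = (ρ : ℂ) * Complex.exp ((θ : ℂ) * Complex.I)}

/-- The real number `μ` is an eigenvalue of the (real) Jacobian of `V` at `z₀`. -/
def IsJacobianEigenvalue (V : ℂ → ℂ) (z₀ : ℂ) (μ : ℝ) : Prop :=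
  Module.End.HasEigenvalue ((fderiv ℝ V z₀ : ℂ →L[ℝ] ℂ) : ℂ →ₗ[ℝ] ℂ) μ

/-- A (hyperbolic) saddle: a critical point whose Jacobian has one negative and one positive
real eigenvalue. -/
def IsSaddle (V : ℂ → ℂ) (z₀ : ℂ) : Prop :=
  V z₀ = 0 ∧ DifferentiableAt ℝ V z₀ ∧
    ∃ a b : ℝ, a < 0 ∧ 0 < b ∧ IsJacobianEigenvalue V z₀ a ∧ IsJacobianEigenvalue V z₀ b

/-- A saddle-node: a critical point that is semi-hyperbolic (the Jacobian has a zero and a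
nonzero eigenvalue) and at which the quadratic term of the flow along the kernel direction does
not vanish: with `v` and `w` a right and a left null vector of the Jacobian,
`w (D²V(z₀)(v, v)) ≠ 0`. -/
def IsSaddleNode (V : ℂ → ℂ) (z₀ : ℂ) : Prop :=
  V z₀ = 0 ∧ ContDiffAt ℝ 2 V z₀ ∧
    (∃ μ : ℝ, μ ≠ 0 ∧ IsJacobianEigenvalue V z₀ μ) ∧
    ∃ (v : ℂ) (w : ℂ →L[ℝ] ℝ), v ≠ 0 ∧ w ≠ 0 ∧
      fderiv ℝ V z₀ v = 0 ∧ (∀ x : ℂ, w (fderiv ℝ V z₀ x) = 0) ∧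
      iteratedDeriv 2 (fun t : ℝ => w (V (z₀ + (t : ℂ) * v))) 0 ≠ 0

/-- `z₀` is an isolated critical point of `V` of Poincaré index `n`: on every sufficiently small
circle around `z₀`, the field `V` has no zero and its argument, followed continuously once around
the circle counterclockwise, increases by `2πn`. -/
def HasPoincareIndex (V : ℂ → ℂ) (z₀ : ℂ) (n : ℤ) : Prop :=
  V z₀ = 0 ∧ ∃ ε : ℝ, 0 < ε ∧ ∀ ρ : ℝ, 0 < ρ → ρ < ε →
    ∃ φ : ℝ → ℝ, ContinuousOn φ (Set.Icc 0 (2 * Real.pi)) ∧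
      (∀ t ∈ Set.Icc (0 : ℝ) (2 * Real.pi),
        V (z₀ + (ρ : ℂ) * Complex.exp ((t : ℂ) * Complex.I)) ≠ 0 ∧
        V (z₀ + (ρ : ℂ) * Complex.exp ((t : ℂ) * Complex.I)) =
          (‖V (z₀ + (ρ : ℂ) * Complex.exp ((t : ℂ) * Complex.I))‖ : ℂ) *
            Complex.exp ((φ t : ℂ) * Complex.I)) ∧
      φ (2 * Real.pi) - φ 0 = 2 * Real.pi * n

end

/-! Write `p = p₁ + i p₂`, `s = s₁ + i s₂` and `u = e^{-12iθ}`. Away from the origin the field is `z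
(p + |z|² (s - u))`, so with `t = |z|⁻²` a critical point satisfies `u = s + t p`. Nonzero critical
points therefore come in rings: each `t > 0` at which the ray `s + t p` meets the unit circle fixes
the modulus and the phase of `z`, hence `z ^ 12`, and gives twelve points, one per sector
(`mem_criticalPoints_iff`). The form `Q` is a quarter of the discriminant of the quadratic `|s + t
p|² = 1` in `t` (`quadForm_eq`). Since `|s₂| > 1`, the ray starts outside the disc; it misses the
disc if `p₂` does not point towards it, and otherwise the sign of `Q` decides between zero, one
(tangential) and two intersections.

The Jacobian is `x ↦ A x + B x̄`, with determinant `|A|² - |B|² = 24 |z|⁴ (Re(s ū) - 1)`. On a ring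
this is a negative multiple of the `t`-derivative of `|s + t p|²` (`re_mul_conj_phase`): positive
where the ray enters the disc (index `1`), negative where it leaves (saddle, index `-1`), zero at
tangency.

At tangency the index is `0` because, after division by a nowhere winding factor, the field stays in
a closed half plane and has no zero nearby. The quadratic coefficient along the kernel is a positive
multiple of `k²`, where `s = u (1 + i k)`, and `k ≠ 0` since `|s| > 1`; so only the trace decides
whether the point is a saddle-node. -/

open Filter Topology ComplexConjugate

/-! ### Poincaré index: computation and uniqueness. -/

/-- If, on small circles around `z₀`, the field is the rotating vector `G e^{int}` up to two factors
that avoid the negative real axis, the first of which is continuous near `z₀`, then the index at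
`z₀` is `n`. -/
theorem hasPoincareIndex_of_mem_slitPlane {V m : ℂ → ℂ} {z₀ G : ℂ} {n : ℤ} (hG : G ≠ 0)
    (h0 : V z₀ = 0) (hV : ∀ᶠ z in 𝓝 z₀, ContinuousAt V z) (hm : ∀ᶠ z in 𝓝 z₀, ContinuousAt m z)
    (hms : ∀ᶠ z in 𝓝 z₀, m z ∈ Complex.slitPlane)
    (h : ∃ ε : ℝ, 0 < ε ∧ ∀ ρ : ℝ, 0 < ρ → ρ < ε → ∀ t : ℝ,
      V (z₀ + (ρ : ℂ) * Complex.exp ((t : ℂ) * Complex.I)) /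
        (G * Complex.exp (((n * t : ℝ) : ℂ) * Complex.I) *
          m (z₀ + (ρ : ℂ) * Complex.exp ((t : ℂ) * Complex.I))) ∈ Complex.slitPlane) :
    HasPoincareIndex V z₀ n := by
  obtain ⟨ε, hε, h⟩ := h
  obtain ⟨δ, hδ, hball⟩ := Metric.eventually_nhds_iff.1 (hV.and (hm.and hms))
  refine ⟨h0, min ε δ, lt_min hε hδ, fun ρ hρ hρlt => ?_⟩
  have hρε := hρlt.trans_le (min_le_left _ _)
  have hρδ := hρlt.trans_le (min_le_right _ _)
  set c : ℝ → ℂ := fun t => z₀ + (ρ : ℂ) * Complex.exp ((t : ℂ) * Complex.I) with hc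
  have hcc : Continuous c := by fun_prop
  have hcd : ∀ t, dist (c t) z₀ < δ := fun t => by
    simpa [hc, dist_eq_norm, Complex.norm_exp_ofReal_mul_I, abs_of_pos hρ] using hρδ
  set q : ℝ → ℂ := fun t => V (c t) / (G * Complex.exp (((n * t : ℝ) : ℂ) * Complex.I) * m (c t))
    with hq
  have hqs : ∀ t, q t ∈ Complex.slitPlane := h ρ hρ hρε
  have hmne : ∀ t, m (c t) ≠ 0 := fun t => Complex.slitPlane_ne_zero (hball (hcd t)).2.2
  have hVc : Continuous fun t => V (c t) := continuous_iff_continuousAt.2 fun t =>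
    ContinuousAt.comp (f := c) (hball (hcd t)).1 hcc.continuousAt
  have hmc : Continuous fun t => m (c t) := continuous_iff_continuousAt.2 fun t =>
    ContinuousAt.comp (f := c) (hball (hcd t)).2.1 hcc.continuousAt
  have hqc : Continuous q := hVc.div (Continuous.mul (by fun_prop) hmc) fun t =>
    mul_ne_zero (mul_ne_zero hG (Complex.exp_ne_zero _)) (hmne t)
  have hprod : ∀ t, V (c t) =
      G * Complex.exp (((n * t : ℝ) : ℂ) * Complex.I) * m (c t) * q t := fun t =>
    (mul_div_cancel₀ _ (mul_ne_zero (mul_ne_zero hG (Complex.exp_ne_zero _)) (hmne t))).symm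
  -- Principal arguments are continuous on the slit plane, and those of `m` and `q` return to their
  -- initial values; only `n * t` contributes to the winding.
  refine ⟨fun t => G.arg + n * t + (m (c t)).arg + (q t).arg, ?_, fun t _ => ⟨?_, ?_⟩, ?_⟩
  · refine Continuous.continuousOn (((continuous_const.add (by fun_prop)).add ?_).add ?_)
    · exact continuous_iff_continuousAt.2 fun t =>
        ContinuousAt.comp (f := fun t => m (c t)) (Complex.continuousAt_arg (hball (hcd t)).2.2)
          hmc.continuousAt
    · exact continuous_iff_continuousAt.2 fun t =>
        (Complex.continuousAt_arg (hqs t)).comp hqc.continuousAt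
  · intro hz
    exact Complex.slitPlane_ne_zero (hqs t) (by simp only [hq, hc, hz, zero_div])
  · have hn : ‖V (c t)‖ = ‖G‖ * ‖m (c t)‖ * ‖q t‖ := by
      rw [hprod t]; simp only [norm_mul, Complex.norm_exp_ofReal_mul_I, mul_one]
    change V (c t) = (‖V (c t)‖ : ℂ) * _
    rw [hn, hprod t]
    conv_lhs => rw [← Complex.norm_mul_exp_arg_mul_I G, ← Complex.norm_mul_exp_arg_mul_I (m (c t)),
      ← Complex.norm_mul_exp_arg_mul_I (q t)]
    push_cast
    simp only [add_mul, Complex.exp_add]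
    ring
  · have hper : c (2 * Real.pi) = c 0 := by
      simp [hc, Complex.exp_two_pi_mul_I]
    have hqper : q (2 * Real.pi) = q 0 := by
      have : Complex.exp (((n * (2 * Real.pi) : ℝ) : ℂ) * Complex.I) = 1 := by
        rw [Complex.exp_eq_one_iff]; exact ⟨n, by push_cast; ring⟩
      simp only [hq, hper, this]
      simp
    simp only [hper, hqper]
    ring

/-- The Poincaré index is unique. -/
theorem HasPoincareIndex.unique {V : ℂ → ℂ} {z₀ : ℂ} {m n : ℤ} (hm : HasPoincareIndex V z₀ m)
    (hn : HasPoincareIndex V z₀ n) : m = n := by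
  obtain ⟨-, ε, hε, hm⟩ := hm
  obtain ⟨-, δ, hδ, hn⟩ := hn
  have hρ : 0 < min ε δ / 2 := half_pos (lt_min hε hδ)
  have hlt : min ε δ / 2 < min ε δ := half_lt_self (lt_min hε hδ)
  obtain ⟨φ, hφc, hφ, hφe⟩ := hm _ hρ (hlt.trans_le (min_le_left _ _))
  obtain ⟨ψ, hψc, hψ, hψe⟩ := hn _ hρ (hlt.trans_le (min_le_right _ _))
  have hpi := Real.pi_pos
  have hdiff : ∀ t ∈ Set.Icc (0 : ℝ) (2 * Real.pi), ∃ k : ℤ, φ t - ψ t = k * (2 * Real.pi) := by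
    intro t ht
    obtain ⟨hne, h1⟩ := hφ t ht
    obtain ⟨-, h2⟩ := hψ t ht
    have h3 := h1.symm.trans h2
    have h4 := mul_left_cancel₀ (by simpa using hne) h3
    obtain ⟨k, hk⟩ := Complex.exp_eq_exp_iff_exists_int.1 h4
    refine ⟨k, ?_⟩
    have h5 : ((φ t : ℂ) - ψ t - k * (2 * Real.pi)) * Complex.I = 0 := by linear_combination hk
    have h6 := (mul_eq_zero.1 h5).resolve_right Complex.I_ne_zero
    have h7 : φ t - ψ t - k * (2 * Real.pi) = 0 := by exact_mod_cast h6
    linarith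
  -- Two continuous arguments differ by a continuous integer multiple of `2π`, which is constant on
  -- the connected interval.
  have hdisc : IsDiscrete (Set.range fun k : ℤ => (k : ℝ)) :=
    ⟨Int.isClosedEmbedding_coe_real.isEmbedding.toHomeomorph.symm.isEmbedding.discreteTopology⟩
  have hmaps : Set.MapsTo (fun t => (φ t - ψ t) / (2 * Real.pi)) (Set.Icc 0 (2 * Real.pi))
      (Set.range fun k : ℤ => (k : ℝ)) := by
    intro t ht
    obtain ⟨k, hk⟩ := hdiff t ht
    exact ⟨k, by simp only [hk]; field_simp⟩
  obtain ⟨y, -, hy⟩ := isPreconnected_Icc.eqOn_const_of_mapsTo hdisc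
    ((hφc.sub hψc).div_const _) hmaps ⟨0, 0, by simp⟩
  have h0 := hy (Set.left_mem_Icc.2 (by positivity))
  have h1 := hy (Set.right_mem_Icc.2 (by positivity))
  simp only [Function.const] at h0 h1
  have h2 : φ (2 * Real.pi) - ψ (2 * Real.pi) = φ 0 - ψ 0 := by
    have := h1.trans h0.symm
    rwa [div_left_inj' (by positivity)] at this
  have h3 : 2 * Real.pi * (m : ℝ) = 2 * Real.pi * n := by linarith
  exact_mod_cast mul_left_cancel₀ (by positivity) h3

/-! ### Index, eigenvalues and saddles from the Wirtinger derivatives. -/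

/-- The real-linear map `x ↦ A x + B x̄` of the plane. -/
noncomputable def wirtingerMap (A B : ℂ) : ℂ →L[ℝ] ℂ :=
  A • ContinuousLinearMap.id ℝ ℂ + B • (Complex.conjCLE : ℂ →L[ℝ] ℂ)

@[simp] theorem wirtingerMap_apply (A B x : ℂ) : wirtingerMap A B x = A * x + B * conj x := by
  simp [wirtingerMap]

theorem mem_slitPlane_of_norm_sub_one_lt {w : ℂ} (h : ‖w - 1‖ < 1) : w ∈ Complex.slitPlane := by
  simpa using Complex.mem_slitPlane_of_norm_lt_one h

/-- On small circles around a zero `z₀`, a differentiable field is close to its linear part. -/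
theorem exists_norm_field_sub_linear_lt {V : ℂ → ℂ} {z₀ A B : ℂ} {η : ℝ} (hη : 0 < η)
    (h0 : V z₀ = 0) (hd : HasFDerivAt V (wirtingerMap A B) z₀) :
    ∃ ε : ℝ, 0 < ε ∧ ∀ ρ : ℝ, 0 < ρ → ρ < ε → ∀ t : ℝ,
      ‖V (z₀ + (ρ : ℂ) * Complex.exp ((t : ℂ) * Complex.I)) -
        ρ * (A * Complex.exp ((t : ℂ) * Complex.I) + B * Complex.exp (-(t : ℂ) * Complex.I))‖ ≤
        η * ρ := by
  have h := (hasFDerivAt_iff_isLittleO_nhds_zero.1 hd).def hη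
  obtain ⟨ε, hε, hb⟩ := Metric.eventually_nhds_iff.1 h
  refine ⟨ε, hε, fun ρ hρ hlt t => ?_⟩
  have hn : ‖(ρ : ℂ) * Complex.exp ((t : ℂ) * Complex.I)‖ = ρ := by
    simp [Complex.norm_exp_ofReal_mul_I, abs_of_pos hρ]
  have := hb (y := (ρ : ℂ) * Complex.exp ((t : ℂ) * Complex.I))
    (by rw [dist_zero_right, hn]; exact hlt)
  rw [hn, h0] at this
  have hconj : conj (Complex.exp ((t : ℂ) * Complex.I)) = Complex.exp (-(t : ℂ) * Complex.I) := by
    rw [← Complex.exp_conj]; simp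
  refine le_of_eq_of_le (congrArg norm ?_) this
  rw [wirtingerMap_apply, map_mul, hconj, Complex.conj_ofReal]
  ring

/-- Rouché-type comparison: of `A e^{it}` and `B e^{-it}` the larger one, `C e^{int}` with `n = ±1`
in the applications, dictates the winding. Half the gap `‖C‖ - ‖D‖` absorbs the nonlinear remainder.
-/
theorem hasPoincareIndex_of_norm_linear_sub_lt {V : ℂ → ℂ} {z₀ A B C D : ℂ} {n : ℤ}
    (h0 : V z₀ = 0) (hV : ∀ᶠ z in 𝓝 z₀, ContinuousAt V z)
    (hd : HasFDerivAt V (wirtingerMap A B) z₀) (hCD : ‖D‖ < ‖C‖)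
    (hl : ∀ t : ℝ, ‖A * Complex.exp ((t : ℂ) * Complex.I) + B * Complex.exp (-(t : ℂ) * Complex.I) -
      C * Complex.exp (((n * t : ℝ) : ℂ) * Complex.I)‖ = ‖D‖) :
    HasPoincareIndex V z₀ n := by
  have hC : C ≠ 0 := by rintro rfl; simp at hCD; linarith [norm_nonneg D]
  obtain ⟨ε, hε, h⟩ := exists_norm_field_sub_linear_lt (η := (‖C‖ - ‖D‖) / 2) (by linarith) h0 hd
  refine hasPoincareIndex_of_mem_slitPlane (m := fun _ => 1) hC h0 hV
    (Eventually.of_forall fun _ => continuousAt_const) (Eventually.of_forall fun _ => by simp)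
    ⟨ε, hε, fun ρ hρ hlt t => ?_⟩
  have h1 := h ρ hρ hlt t
  set W := V (z₀ + (ρ : ℂ) * Complex.exp ((t : ℂ) * Complex.I))
  set E := C * Complex.exp (((n * t : ℝ) : ℂ) * Complex.I) with hE
  have hEn : ‖E‖ = ‖C‖ := by rw [hE, norm_mul, Complex.norm_exp_ofReal_mul_I, mul_one]
  have hE0 : E ≠ 0 := by rw [← norm_pos_iff, hEn]; exact norm_pos_iff.2 hC
  have h2 : ‖W - ρ * E‖ < ρ * ‖C‖ := by
    have h3 := norm_add_le (W - ρ * (A * Complex.exp ((t : ℂ) * Complex.I) +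
      B * Complex.exp (-(t : ℂ) * Complex.I))) (ρ * (A * Complex.exp ((t : ℂ) * Complex.I) +
        B * Complex.exp (-(t : ℂ) * Complex.I) - E))
    rw [norm_mul (ρ : ℂ), hl t, Complex.norm_real, Real.norm_of_nonneg hρ.le] at h3
    have h4 : W - ρ * E = W - ρ * (A * Complex.exp ((t : ℂ) * Complex.I) +
      B * Complex.exp (-(t : ℂ) * Complex.I)) + ρ * (A * Complex.exp ((t : ℂ) * Complex.I) +
        B * Complex.exp (-(t : ℂ) * Complex.I) - E) := by ring
    rw [h4]
    nlinarith
  have hρ0 : (ρ : ℂ) ≠ 0 := by exact_mod_cast hρ.ne'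
  have h5 : W / (ρ * E) ∈ Complex.slitPlane := by
    apply mem_slitPlane_of_norm_sub_one_lt
    rw [div_sub_one (mul_ne_zero hρ0 hE0), norm_div, norm_mul, Complex.norm_real,
      Real.norm_of_nonneg hρ.le, hEn, div_lt_one (mul_pos hρ (norm_pos_iff.2 hC))]
    exact h2
  have h6 : W / (E * 1) = (ρ : ℝ) * (W / (ρ * E)) := by field_simp
  rw [h6, Complex.mem_slitPlane_iff]
  rw [Complex.mem_slitPlane_iff] at h5
  rw [Complex.re_ofReal_mul, Complex.im_ofReal_mul]
  exact h5.imp (mul_pos hρ) (mul_ne_zero hρ.ne')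

/-- A zero with positive Jacobian determinant has index `1`. -/
theorem hasPoincareIndex_one {V : ℂ → ℂ} {z₀ A B : ℂ} (h0 : V z₀ = 0)
    (hV : ∀ᶠ z in 𝓝 z₀, ContinuousAt V z) (hd : HasFDerivAt V (wirtingerMap A B) z₀)
    (hAB : ‖B‖ < ‖A‖) : HasPoincareIndex V z₀ 1 := by
  refine hasPoincareIndex_of_norm_linear_sub_lt h0 hV hd hAB fun t => ?_
  have h := Complex.norm_exp_ofReal_mul_I (-t)
  rw [Complex.ofReal_neg] at h
  have h1 : ((((1 : ℤ) : ℝ) * t : ℝ) : ℂ) = t := by simp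
  rw [h1, add_sub_cancel_left, norm_mul, h, mul_one]

/-- A zero with negative Jacobian determinant has index `-1`. -/
theorem hasPoincareIndex_neg_one {V : ℂ → ℂ} {z₀ A B : ℂ} (h0 : V z₀ = 0)
    (hV : ∀ᶠ z in 𝓝 z₀, ContinuousAt V z) (hd : HasFDerivAt V (wirtingerMap A B) z₀)
    (hAB : ‖A‖ < ‖B‖) : HasPoincareIndex V z₀ (-1) := by
  refine hasPoincareIndex_of_norm_linear_sub_lt h0 hV hd hAB fun t => ?_
  simp

/-- The map `x ↦ C x + B x̄` has determinant `|C|² - |B|² = 0`, so its adjugate `y ↦ C̄ y - B ȳ`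
takes values in its kernel. If the adjugate vanishes at both `1` and `i`, then `B = C = 0`. -/
theorem exists_ne_zero_mul_add_mul_conj_eq_zero {C B : ℂ} (h : ‖C‖ = ‖B‖) :
    ∃ x : ℂ, x ≠ 0 ∧ C * x + B * conj x = 0 := by
  have hsq : C * conj C = B * conj B := by
    rw [Complex.mul_conj', Complex.mul_conj', h]
  have key : ∀ y : ℂ, C * (conj C * y - B * conj y) + B * conj (conj C * y - B * conj y) = 0 := by
    intro y
    simp only [map_sub, map_mul, Complex.conj_conj]
    linear_combination y * hsq
  by_cases h1 : conj C - B = 0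
  · by_cases h2 : conj C + B = 0
    · have hB : B = 0 := by linear_combination (h2 - h1) / 2
      have hC : C = 0 := by rw [← norm_eq_zero, h, hB, norm_zero]
      exact ⟨1, one_ne_zero, by simp [hB, hC]⟩
    · refine ⟨_, fun h3 => h2 ?_, key Complex.I⟩
      have : Complex.I * (conj C + B) = 0 := by
        rw [← h3, Complex.conj_I]; ring
      exact (mul_eq_zero.1 this).resolve_left Complex.I_ne_zero
  · exact ⟨_, fun h3 => h1 (by simpa using h3), key 1⟩

/-- The characteristic equation of the Jacobian in terms of the Wirtinger derivatives. -/
theorem isJacobianEigenvalue_iff {V : ℂ → ℂ} {z₀ A B : ℂ} {μ : ℝ}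
    (hd : HasFDerivAt V (wirtingerMap A B) z₀) :
    IsJacobianEigenvalue V z₀ μ ↔ μ ^ 2 - 2 * A.re * μ + (‖A‖ ^ 2 - ‖B‖ ^ 2) = 0 := by
  -- The right side is the determinant of `x ↦ (A - μ) x + B x̄`.
  have hchar : μ ^ 2 - 2 * A.re * μ + (‖A‖ ^ 2 - ‖B‖ ^ 2) = ‖A - μ‖ ^ 2 - ‖B‖ ^ 2 := by
    simp only [← Complex.normSq_eq_norm_sq, Complex.normSq_apply]
    simp
    ring
  rw [hchar, sub_eq_zero, sq_eq_sq₀ (norm_nonneg _) (norm_nonneg _)]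
  unfold IsJacobianEigenvalue
  rw [hd.fderiv]
  constructor
  · intro h
    obtain ⟨x, hx⟩ := h.exists_hasEigenvector
    have h1 := hx.apply_eq_smul
    rw [ContinuousLinearMap.coe_coe, wirtingerMap_apply, Complex.real_smul] at h1
    have h2 : (A - μ) * x = -(B * conj x) := by linear_combination h1
    have h3 := congrArg norm h2
    rw [norm_neg, norm_mul, norm_mul, Complex.norm_conj] at h3
    exact mul_right_cancel₀ (norm_ne_zero_iff.2 hx.2) h3
  · intro h
    obtain ⟨x, hx0, hx⟩ := exists_ne_zero_mul_add_mul_conj_eq_zero h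
    refine Module.End.hasEigenvalue_of_hasEigenvector (x := x)
      ⟨Module.End.mem_eigenspace_iff.2 ?_, hx0⟩
    rw [ContinuousLinearMap.coe_coe, wirtingerMap_apply, Complex.real_smul]
    linear_combination hx

/-- A zero is a saddle if and only if its Jacobian determinant is negative. -/
theorem isSaddle_iff {V : ℂ → ℂ} {z₀ A B : ℂ} (h0 : V z₀ = 0)
    (hd : HasFDerivAt V (wirtingerMap A B) z₀) : IsSaddle V z₀ ↔ ‖A‖ < ‖B‖ := by
  unfold IsSaddle
  simp only [isJacobianEigenvalue_iff hd]
  constructor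
  · rintro ⟨-, -, a, b, ha, hb, hea, heb⟩
    have h1 : (a - b) * (a + b - 2 * A.re) = 0 := by linear_combination hea - heb
    have h2 : a + b - 2 * A.re = 0 := (mul_eq_zero.1 h1).resolve_left (by linarith)
    have h3 : ‖A‖ ^ 2 - ‖B‖ ^ 2 = a * b := by linear_combination hea - a * h2
    exact lt_of_pow_lt_pow_left₀ 2 (norm_nonneg _) (by nlinarith)
  · intro h
    have hneg : ‖A‖ ^ 2 - ‖B‖ ^ 2 < 0 := by nlinarith [norm_nonneg A]
    set d := ‖A‖ ^ 2 - ‖B‖ ^ 2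
    have hpos : 0 ≤ A.re ^ 2 - d := by nlinarith [sq_nonneg A.re]
    have hs := Real.sq_sqrt hpos
    have hlt : |A.re| < √(A.re ^ 2 - d) := by
      rw [← Real.sqrt_sq_eq_abs]
      exact Real.sqrt_lt_sqrt (sq_nonneg _) (by linarith)
    obtain ⟨h1, h2⟩ := abs_lt.1 hlt
    exact ⟨h0, hd.differentiableAt, A.re - √(A.re ^ 2 - d), A.re + √(A.re ^ 2 - d),
      by linarith, by linarith, by linear_combination hs, by linear_combination hs⟩

/-! ### The field in complex form and its Jacobian. -/

/-- The unit complex number `e^{-12iθ}`, for `θ` the argument of `z`. -/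
noncomputable def phase (z : ℂ) : ℂ := (conj z / z) ^ 6

theorem norm_phase {z : ℂ} (hz : z ≠ 0) : ‖phase z‖ = 1 := by
  rw [phase, norm_pow, norm_div, Complex.norm_conj, div_self (norm_ne_zero_iff.2 hz), one_pow]

theorem phase_eq_exp {z : ℂ} (hz : z ≠ 0) :
    phase z = Real.cos (12 * z.arg) - Real.sin (12 * z.arg) * Complex.I := by
  have hn : (‖z‖ : ℂ) ≠ 0 := by exact_mod_cast norm_ne_zero_iff.2 hz
  have h1 : conj z / z = Complex.exp (-2 * z.arg * Complex.I) := by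
    have h2 : conj z = ‖z‖ * Complex.exp (-z.arg * Complex.I) := by
      conv_lhs => rw [← Complex.norm_mul_exp_arg_mul_I z]
      rw [map_mul, Complex.conj_ofReal, ← Complex.exp_conj]
      simp
    rw [div_eq_iff hz, h2]
    conv_rhs => rw [← Complex.norm_mul_exp_arg_mul_I z]
    rw [mul_left_comm, ← Complex.exp_add]
    congr 2
    simp
    ring
  rw [phase, h1, ← Complex.exp_nat_mul]
  have h3 : ((6 : ℕ) : ℂ) * (-2 * z.arg * Complex.I) = ((-(12 * z.arg) : ℝ) : ℂ) * Complex.I := by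
    push_cast; ring
  rw [h3, Complex.exp_mul_I, ← Complex.ofReal_cos, ← Complex.ofReal_sin, Real.cos_neg, Real.sin_neg]
  push_cast; ring

theorem planarField_zero (p₁ p₂ s₁ s₂ : ℝ) : planarField p₁ p₂ s₁ s₂ 0 = 0 := by
  simp [planarField]

theorem planarField_eq_mul (p₁ p₂ s₁ s₂ : ℝ) {z : ℂ} (hz : z ≠ 0) :
    planarField p₁ p₂ s₁ s₂ z =
      z * ((⟨p₁, p₂⟩ : ℂ) + (‖z‖ ^ 2 : ℝ) * ((⟨s₁, s₂⟩ : ℂ) - phase z)) := by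
  have hn : ‖z‖ ≠ 0 := norm_ne_zero_iff.2 hz
  rw [planarField, phase_eq_exp hz, mul_comm]
  congr 1
  have h1 : polarR p₁ s₁ (‖z‖ ^ 2) z.arg / (2 * ‖z‖ ^ 2) =
      p₁ + ‖z‖ ^ 2 * (s₁ - Real.cos (12 * z.arg)) := by
    rw [polarR]; field_simp
  rw [h1, polarTheta]
  apply Complex.ext
  · simp only [Complex.add_re, Complex.re_ofReal_mul, Complex.sub_re, Complex.ofReal_re,
      Complex.I_re]
    ring
  · simp only [Complex.add_im, Complex.im_ofReal_mul, Complex.sub_im, Complex.ofReal_im,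
      Complex.I_im]
    ring

/-- A rational expression in `z` and `z̄`, suited to differentiation. It also holds at the origin,
where the quotient is `0 / 0 = 0`. -/
theorem planarField_eq (p₁ p₂ s₁ s₂ : ℝ) :
    planarField p₁ p₂ s₁ s₂ = fun z : ℂ => (⟨p₁, p₂⟩ : ℂ) * z + (⟨s₁, s₂⟩ : ℂ) * (z ^ 2 * conj z) -
      conj z ^ 7 / z ^ 4 := by
  funext z
  rcases eq_or_ne z 0 with rfl | hz
  · simp [planarField_zero]
  · rw [planarField_eq_mul _ _ _ _ hz, phase]
    have h : ((‖z‖ ^ 2 : ℝ) : ℂ) = z * conj z := by rw [Complex.mul_conj']; push_cast; rfl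
    rw [h]
    field_simp
    ring

theorem contDiffAt_planarField (p₁ p₂ s₁ s₂ : ℝ) {z : ℂ} (hz : z ≠ 0) {n : WithTop ℕ∞} :
    ContDiffAt ℝ n (planarField p₁ p₂ s₁ s₂) z := by
  rw [planarField_eq]
  simp only [div_eq_mul_inv]
  have hc : ContDiffAt ℝ n (fun z : ℂ => conj z) z := Complex.conjCLE.contDiff.contDiffAt
  have hi : ContDiffAt ℝ n (fun z : ℂ => z) z := contDiffAt_id
  exact ((contDiffAt_const.mul hi).add (contDiffAt_const.mul ((hi.pow 2).mul hc))).sub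
    ((hc.pow 7).mul ((hi.pow 4).inv (pow_ne_zero _ hz)))

theorem eventually_continuousAt_planarField (p₁ p₂ s₁ s₂ : ℝ) {z : ℂ} (hz : z ≠ 0) :
    ∀ᶠ w in 𝓝 z, ContinuousAt (planarField p₁ p₂ s₁ s₂) w := by
  filter_upwards [eventually_ne_nhds hz] with w hw
  exact (contDiffAt_planarField p₁ p₂ s₁ s₂ hw (n := 0)).continuousAt

theorem hasFDerivAt_planarField (p₁ p₂ s₁ s₂ : ℝ) {z : ℂ} (hz : z ≠ 0) :
    HasFDerivAt (planarField p₁ p₂ s₁ s₂)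
      (wirtingerMap ((⟨p₁, p₂⟩ : ℂ) + (‖z‖ ^ 2 : ℝ) * (2 * (⟨s₁, s₂⟩ : ℂ) + 4 * phase z))
        (z ^ 2 * ((⟨s₁, s₂⟩ : ℂ) - 7 * phase z))) z := by
  rw [planarField_eq]
  have hc : HasFDerivAt (fun z : ℂ => conj z) (Complex.conjCLE : ℂ →L[ℝ] ℂ) z :=
    Complex.conjCLE.hasFDerivAt
  have hi : HasFDerivAt (fun z : ℂ => z) (ContinuousLinearMap.id ℝ ℂ) z := hasFDerivAt_id z
  have h := ((hi.const_mul (⟨p₁, p₂⟩ : ℂ)).add (((hi.pow 2).mul hc).const_mul (⟨s₁, s₂⟩ : ℂ))).sub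
    ((hc.pow 7).mul ((hasFDerivAt_inv' (𝕜 := ℝ) (pow_ne_zero 4 hz)).comp z (hi.pow 4)))
  refine HasFDerivAt.congr_fderiv (h.congr_of_eventuallyEq ?_) ?_
  · exact Eventually.of_forall fun w => by simp [div_eq_mul_inv]
  · have hr : ((‖z‖ ^ 2 : ℝ) : ℂ) = z * conj z := by rw [Complex.mul_conj']; push_cast; rfl
    ext x
    rw [wirtingerMap_apply, hr, phase]
    simp
    field_simp
    ring

/-- The Jacobian at a critical point. -/
theorem hasFDerivAt_planarField_of_critical {p₁ p₂ s₁ s₂ : ℝ} {z : ℂ} (hz : z ≠ 0)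
    (hcrit : (⟨p₁, p₂⟩ : ℂ) + (‖z‖ ^ 2 : ℝ) * ((⟨s₁, s₂⟩ : ℂ) - phase z) = 0) :
    HasFDerivAt (planarField p₁ p₂ s₁ s₂)
      (wirtingerMap ((‖z‖ ^ 2 : ℝ) * ((⟨s₁, s₂⟩ : ℂ) + 5 * phase z))
        (z ^ 2 * ((⟨s₁, s₂⟩ : ℂ) - 7 * phase z))) z := by
  convert hasFDerivAt_planarField p₁ p₂ s₁ s₂ hz using 2
  -- The critical equation replaces `p` by `-|z|² (s - u)`, turning `2s + 4u` into `s + 5u`.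
  linear_combination -hcrit

/-- The Jacobian determinant at a critical point. -/
theorem jacobian_det_of_critical (s : ℂ) {z : ℂ} (hz : z ≠ 0) :
    ‖(‖z‖ ^ 2 : ℝ) * (s + 5 * phase z)‖ ^ 2 - ‖z ^ 2 * (s - 7 * phase z)‖ ^ 2 =
      24 * ‖z‖ ^ 4 * ((s * conj (phase z)).re - 1) := by
  have hu : (phase z).re * (phase z).re + (phase z).im * (phase z).im = 1 := by
    rw [← Complex.normSq_apply, Complex.normSq_eq_norm_sq, norm_phase hz, one_pow]
  rw [norm_mul, norm_mul, Complex.norm_real, norm_pow z, Real.norm_of_nonneg (by positivity),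
    mul_pow, mul_pow, ← Complex.normSq_eq_norm_sq (s + _), ← Complex.normSq_eq_norm_sq (s - _)]
  simp [Complex.normSq_apply]
  linear_combination (-24 * ‖z‖ ^ 4) * hu

/-! ### Critical points with vanishing Jacobian determinant. -/

/-- At an isolated critical point at which the Jacobian determinant vanishes the index is `0`. -/
theorem hasPoincareIndex_zero_of_critical {p₁ p₂ s₁ s₂ : ℝ} {z : ℂ} (hz : z ≠ 0)
    (hcrit : (⟨p₁, p₂⟩ : ℂ) + (‖z‖ ^ 2 : ℝ) * ((⟨s₁, s₂⟩ : ℂ) - phase z) = 0)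
    (hdet : ((⟨s₁, s₂⟩ : ℂ) * conj (phase z)).re = 1)
    (hiso : ∀ᶠ w in 𝓝[≠] z, planarField p₁ p₂ s₁ s₂ w ≠ 0) :
    HasPoincareIndex (planarField p₁ p₂ s₁ s₂) z 0 := by
  have hu0 : phase z ≠ 0 := by rw [← norm_ne_zero_iff, norm_phase hz]; exact one_ne_zero
  have huu : phase z * conj (phase z) = 1 := by rw [Complex.mul_conj', norm_phase hz]; simp
  have hm : ∀ w : ℂ, ContinuousAt (fun w => w / z) w := fun w => by fun_prop
  -- Dividing by `u z · (w / z) = u w` leaves `ū (p + |w|² (s - u_w))`, where `u = phase z` and `u_w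
  -- = phase w`.
  refine hasPoincareIndex_of_mem_slitPlane (G := phase z * z) (m := fun w => w / z)
    (mul_ne_zero hu0 hz) ?_ (eventually_continuousAt_planarField _ _ _ _ hz)
    (Eventually.of_forall hm) ?_ ?_
  · rw [planarField_eq_mul _ _ _ _ hz, hcrit, mul_zero]
  · apply (hm z).eventually (Complex.isOpen_slitPlane.mem_nhds _)
    simp [hz]
  obtain ⟨ε, hε, hb⟩ := Metric.eventually_nhds_iff.1
    ((eventually_nhdsWithin_iff.1 hiso).and (eventually_ne_nhds hz))
  refine ⟨ε, hε, fun ρ hρ hlt t => ?_⟩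
  set w := z + (ρ : ℂ) * Complex.exp ((t : ℂ) * Complex.I) with hw
  have hρ0 : (ρ : ℂ) * Complex.exp ((t : ℂ) * Complex.I) ≠ 0 :=
    mul_ne_zero (by exact_mod_cast hρ.ne') (Complex.exp_ne_zero _)
  obtain ⟨hne, hw0⟩ := hb (y := w) (by
    simpa [hw, dist_eq_norm, Complex.norm_exp_ofReal_mul_I, abs_of_pos hρ] using hlt)
  have hne := hne (by simpa [hw] using hρ0)
  have hq : planarField p₁ p₂ s₁ s₂ w /
      (phase z * z * Complex.exp ((((0 : ℤ) * t : ℝ) : ℂ) * Complex.I) * (w / z)) =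
      conj (phase z) * ((⟨p₁, p₂⟩ : ℂ) + (‖w‖ ^ 2 : ℝ) * ((⟨s₁, s₂⟩ : ℂ) - phase w)) := by
    rw [planarField_eq_mul _ _ _ _ hw0]
    have : conj (phase z) = (phase z)⁻¹ := (eq_inv_of_mul_eq_one_right huu)
    rw [this]
    simp only [Int.cast_zero, zero_mul, Complex.ofReal_zero, Complex.exp_zero, mul_one]
    field_simp
  have hqne : planarField p₁ p₂ s₁ s₂ w /
      (phase z * z * Complex.exp ((((0 : ℤ) * t : ℝ) : ℂ) * Complex.I) * (w / z)) ≠ 0 :=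
    div_ne_zero hne (mul_ne_zero (mul_ne_zero (mul_ne_zero hu0 hz) (Complex.exp_ne_zero _))
      (div_ne_zero hw0 hz))
  -- By the critical equation and `Re(s ū) = 1`, this real part equals `|w|² (1 - Re(ū u_w))`. As
  -- the quotient is nonzero, it avoids the closed negative axis.
  have hre : 0 ≤ (conj (phase z) *
      ((⟨p₁, p₂⟩ : ℂ) + (‖w‖ ^ 2 : ℝ) * ((⟨s₁, s₂⟩ : ℂ) - phase w))).re := by
    have h1 : conj (phase z) * ((⟨p₁, p₂⟩ : ℂ) + (‖w‖ ^ 2 : ℝ) * ((⟨s₁, s₂⟩ : ℂ) - phase w)) =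
        (‖z‖ ^ 2 : ℝ) * (1 - (⟨s₁, s₂⟩ : ℂ) * conj (phase z)) +
        (‖w‖ ^ 2 : ℝ) * ((⟨s₁, s₂⟩ : ℂ) * conj (phase z) - conj (phase z) * phase w) := by
      linear_combination conj (phase z) * hcrit + ((‖z‖ ^ 2 : ℝ) : ℂ) * huu
    have h2 : (conj (phase z) * phase w).re ≤ 1 := by
      refine (Complex.re_le_norm _).trans ?_
      rw [norm_mul, Complex.norm_conj, norm_phase hz, norm_phase hw0, one_mul]
    rw [h1, Complex.add_re, Complex.re_ofReal_mul, Complex.re_ofReal_mul, Complex.sub_re,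
      Complex.sub_re, hdet, Complex.one_re]
    have := mul_nonneg (sq_nonneg ‖w‖) (sub_nonneg.2 h2)
    linarith
  rw [hq] at hqne ⊢
  rw [Complex.mem_slitPlane_iff]
  by_contra! hcon
  exact hqne (Complex.ext (le_antisymm hcon.1 hre) hcon.2)

/-- The second derivative of the field along a line through `z`. -/
theorem iteratedDeriv_two_planarField (p₁ p₂ s₁ s₂ : ℝ) {z : ℂ} (hz : z ≠ 0) (ν : ℂ)
    (w : ℂ →L[ℝ] ℝ) :
    iteratedDeriv 2 (fun t : ℝ => w (planarField p₁ p₂ s₁ s₂ (z + (t : ℂ) * (z * ν)))) 0 =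
      w ((‖z‖ ^ 2 : ℝ) * z * ((⟨s₁, s₂⟩ : ℂ) * (2 * ν ^ 2 + 4 * ν * conj ν) -
        phase z * (42 * conj ν ^ 2 - 56 * ν * conj ν + 20 * ν ^ 2))) := by
  rw [planarField_eq]
  set p : ℂ := ⟨p₁, p₂⟩
  set s : ℂ := ⟨s₁, s₂⟩
  set v := z * ν with hv
  have hl : ∀ t : ℝ, HasDerivAt (fun t : ℝ => z + (t : ℂ) * v) v t := fun t => by
    simpa using ((Complex.ofRealCLM.hasDerivAt (x := t)).mul_const v).const_add z
  have hlc : ∀ t : ℝ, HasDerivAt (fun t : ℝ => conj (z + (t : ℂ) * v)) (conj v) t := fun t =>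
    (Complex.conjCLE : ℂ →L[ℝ] ℂ).hasFDerivAt.comp_hasDerivAt t (hl t)
  have hz' : ∀ᶠ t : ℝ in 𝓝 0, z + (t : ℂ) * v ≠ 0 := by
    have : ContinuousAt (fun t : ℝ => z + (t : ℂ) * v) 0 := (hl 0).continuousAt
    exact this.eventually_ne (by simpa using hz)
  have h1 : deriv (fun t : ℝ => w (p * (z + (t : ℂ) * v) +
      s * ((z + (t : ℂ) * v) ^ 2 * conj (z + (t : ℂ) * v)) -
      conj (z + (t : ℂ) * v) ^ 7 / (z + (t : ℂ) * v) ^ 4)) =ᶠ[𝓝 0]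
      fun t : ℝ => w (p * v + s * (2 * (z + (t : ℂ) * v) * v * conj (z + (t : ℂ) * v) +
        (z + (t : ℂ) * v) ^ 2 * conj v) -
        (7 * conj (z + (t : ℂ) * v) ^ 6 * conj v / (z + (t : ℂ) * v) ^ 4 -
          4 * conj (z + (t : ℂ) * v) ^ 7 * v / (z + (t : ℂ) * v) ^ 5)) := by
    filter_upwards [hz'] with t ht
    have h := (((hl t).const_mul p).add ((((hl t).pow 2).mul (hlc t)).const_mul s)).sub
      (((hlc t).pow 7).div ((hl t).pow 4) (pow_ne_zero 4 ht))
    refine ((w.hasFDerivAt.comp_hasDerivAt t h).congr_deriv ?_).deriv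
    congr 1
    simp only [Pi.pow_apply, Nat.cast_ofNat]
    generalize conj (z + (t : ℂ) * v) = ζc
    generalize z + (t : ℂ) * v = ζ at ht ⊢
    field_simp
    ring
  rw [iteratedDeriv_succ, iteratedDeriv_one]
  beta_reduce
  rw [h1.deriv_eq]
  have h00 : z + ((0 : ℝ) : ℂ) * v ≠ 0 := by simpa using hz
  have h := (((((((hl 0).const_mul 2).mul_const v).mul (hlc 0)).add
    (((hl 0).pow 2).mul_const (conj v))).const_mul s).const_add (p * v)).sub
    ((((((hlc 0).pow 6).const_mul 7).mul_const (conj v)).div ((hl 0).pow 4)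
      (pow_ne_zero 4 h00)).sub
    (((((hlc 0).pow 7).const_mul 4).mul_const v).div ((hl 0).pow 5) (pow_ne_zero 5 h00)))
  refine ((w.hasFDerivAt.comp_hasDerivAt 0 h).congr_deriv ?_).deriv
  congr 1
  have hr : ((‖z‖ ^ 2 : ℝ) : ℂ) = z * conj z := by rw [Complex.mul_conj']; push_cast; rfl
  rw [hr, phase]
  simp only [Pi.pow_apply, Nat.cast_ofNat, Complex.ofReal_zero, zero_mul, add_zero, hv, map_mul]
  field_simp
  ring

/-- A critical point with vanishing Jacobian determinant is a saddle-node if and only if the trace of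
its Jacobian does not vanish. -/
theorem isSaddleNode_iff_of_critical {p₁ p₂ s₁ s₂ : ℝ} {z : ℂ} (hz : z ≠ 0)
    (hcrit : (⟨p₁, p₂⟩ : ℂ) + (‖z‖ ^ 2 : ℝ) * ((⟨s₁, s₂⟩ : ℂ) - phase z) = 0)
    (hdet : ((⟨s₁, s₂⟩ : ℂ) * conj (phase z)).re = 1)
    (hk : ((⟨s₁, s₂⟩ : ℂ) * conj (phase z)).im ≠ 0) :
    IsSaddleNode (planarField p₁ p₂ s₁ s₂) z ↔ s₁ + 5 * (phase z).re ≠ 0 := by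
  have hd := hasFDerivAt_planarField_of_critical hz hcrit
  have hdet0 := jacobian_det_of_critical ⟨s₁, s₂⟩ hz
  rw [hdet, sub_self, mul_zero] at hdet0
  have hr : (0 : ℝ) < ‖z‖ ^ 2 := by positivity
  have hA : (((‖z‖ ^ 2 : ℝ) : ℂ) * ((⟨s₁, s₂⟩ : ℂ) + 5 * phase z)).re =
      ‖z‖ ^ 2 * (s₁ + 5 * (phase z).re) := by
    rw [Complex.re_ofReal_mul]; simp
  unfold IsSaddleNode
  simp only [isJacobianEigenvalue_iff hd, hdet0, hA]
  constructor
  · rintro ⟨-, -, ⟨μ, hμ, h⟩, -⟩ h0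
    rw [h0] at h
    apply hμ
    simpa using h
  intro htr
  set k := ((⟨s₁, s₂⟩ : ℂ) * conj (phase z)).im with hkdef
  have huu : phase z * conj (phase z) = 1 := by rw [Complex.mul_conj', norm_phase hz]; simp
  -- Vanishing determinant means `Re(s ū) = 1`. Now `A = |z|² u (6 + ik)` and `B = z² u (-6 + ik)`,
  -- from which both null vectors are read off.
  have hs : (⟨s₁, s₂⟩ : ℂ) = phase z * (1 + k * Complex.I) := by
    have h1 : (⟨s₁, s₂⟩ : ℂ) * conj (phase z) = 1 + k * Complex.I := by
      apply Complex.ext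
      · rw [hdet]; simp
      · rw [← hkdef]; simp
    linear_combination phase z * h1 - (⟨s₁, s₂⟩ : ℂ) * huu
  have hu0 : phase z ≠ 0 := by rw [← norm_ne_zero_iff, norm_phase hz]; exact one_ne_zero
  have hrz : ((‖z‖ ^ 2 : ℝ) : ℂ) = z * conj z := by rw [Complex.mul_conj']; push_cast; rfl
  -- The nonzero eigenvalue is the trace; the right null vector is `z (6 - ik)`, the left one `x ↦
  -- Re(conj(z u) x)`.
  refine ⟨by rw [planarField_eq_mul _ _ _ _ hz, hcrit, mul_zero],
    contDiffAt_planarField _ _ _ _ hz, ⟨2 * (‖z‖ ^ 2 * (s₁ + 5 * (phase z).re)), ?_, by ring⟩,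
    z * (6 - k * Complex.I), Complex.reCLM.comp (wirtingerMap (conj (z * phase z)) 0), ?_, ?_,
    ?_, ?_, ?_⟩
  · exact mul_ne_zero two_ne_zero (mul_ne_zero hr.ne' htr)
  · refine mul_ne_zero hz fun h => ?_
    simpa using congrArg Complex.re h
  · intro h
    have h1 := congrArg (fun f : ℂ →L[ℝ] ℝ => f (z * phase z)) h
    simp only [ContinuousLinearMap.comp_apply, wirtingerMap_apply, Complex.reCLM_apply, zero_mul,
      add_zero, zero_apply, mul_comm (conj _), Complex.mul_conj,
      Complex.ofReal_re, Complex.normSq_eq_zero, mul_eq_zero, hz, hu0, or_self] at h1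
  · rw [hd.fderiv, wirtingerMap_apply, hs, hrz]
    simp only [map_mul, map_sub, Complex.conj_ofReal, Complex.conj_I, map_ofNat]
    ring
  · intro x
    rw [hd.fderiv]
    simp only [ContinuousLinearMap.comp_apply, wirtingerMap_apply, Complex.reCLM_apply, zero_mul,
      add_zero]
    -- The image of the Jacobian, multiplied by `conj(z u)`, has the form `a - ā`, so it is purely
    -- imaginary.
    have h1 : conj (z * phase z) * (((‖z‖ ^ 2 : ℝ) : ℂ) * ((⟨s₁, s₂⟩ : ℂ) + 5 * phase z) * x +
        z ^ 2 * ((⟨s₁, s₂⟩ : ℂ) - 7 * phase z) * conj x) =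
        (‖z‖ ^ 2 : ℝ) * ((6 + k * Complex.I) * (conj z * x) -
          conj ((6 + k * Complex.I) * (conj z * x))) := by
      rw [hs, hrz]
      simp only [map_mul, map_add, Complex.conj_conj, Complex.conj_ofReal, Complex.conj_I,
        map_ofNat]
      linear_combination (conj z * z * conj z * (6 + k * Complex.I) * x +
        z ^ 2 * conj z * (-6 + k * Complex.I) * conj x) * huu
    rw [h1, Complex.re_ofReal_mul, Complex.sub_re, Complex.conj_re, sub_self, mul_zero]
  · rw [iteratedDeriv_two_planarField _ _ _ _ hz]
    simp only [ContinuousLinearMap.comp_apply, wirtingerMap_apply, Complex.reCLM_apply, zero_mul,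
      add_zero]
    have h1 : conj (z * phase z) * (((‖z‖ ^ 2 : ℝ) : ℂ) * z * ((⟨s₁, s₂⟩ : ℂ) *
        (2 * (6 - k * Complex.I) ^ 2 +
          4 * (6 - k * Complex.I) * conj (6 - k * Complex.I)) -
        phase z * (42 * conj (6 - k * Complex.I) ^ 2 -
          56 * (6 - k * Complex.I) * conj (6 - k * Complex.I) +
          20 * (6 - k * Complex.I) ^ 2))) =
        (‖z‖ ^ 2 * ‖z‖ ^ 2 : ℝ) * ((1 + k * Complex.I) *
          (2 * (6 - k * Complex.I) ^ 2 +
            4 * (6 - k * Complex.I) * (6 + k * Complex.I)) -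
          (42 * (6 + k * Complex.I) ^ 2 -
            56 * (6 - k * Complex.I) * (6 + k * Complex.I) +
            20 * (6 - k * Complex.I) ^ 2)) := by
      have hc : conj (6 - k * Complex.I) = 6 + k * Complex.I := by
        simp only [map_mul, map_sub, Complex.conj_ofReal, Complex.conj_I, map_ofNat]
        ring
      rw [Complex.ofReal_mul, hc, hs, hrz, map_mul]
      linear_combination (z * conj z * (z * conj z) * ((1 + k * Complex.I) *
          (2 * (6 - k * Complex.I) ^ 2 +
            4 * (6 - k * Complex.I) * (6 + k * Complex.I)) -
          (42 * (6 + k * Complex.I) ^ 2 -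
            56 * (6 - k * Complex.I) * (6 + k * Complex.I) +
            20 * (6 - k * Complex.I) ^ 2))) * huu
    rw [h1, Complex.re_ofReal_mul]
    refine mul_ne_zero (by positivity) ?_
    -- The real part is `144 k²`, nonzero by `hk`.
    have h2 : ((1 + k * Complex.I) * (2 * (6 - k * Complex.I) ^ 2 +
            4 * (6 - k * Complex.I) * (6 + k * Complex.I)) -
          (42 * (6 + k * Complex.I) ^ 2 -
            56 * (6 - k * Complex.I) * (6 + k * Complex.I) +
            20 * (6 - k * Complex.I) ^ 2) : ℂ) =
        ((144 * k ^ 2 : ℝ) : ℂ) + ((2 * k ^ 3 - 72 * k : ℝ) : ℂ) * Complex.I := by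
      push_cast
      linear_combination (-144 * (k : ℂ) ^ 2 - 2 * (k : ℂ) ^ 3 * Complex.I) * Complex.I_sq
    rw [h2, Complex.add_re, Complex.ofReal_re, Complex.re_ofReal_mul, Complex.I_re, mul_zero,
      add_zero]
    positivity

/-! ### Twelfth roots and rings of critical points. -/

/-- A nonzero complex number has exactly one twelfth root in each sector of angle `2π/12`. -/
theorem existsUnique_pow_twelve_eq_mem_sector {c : ℂ} (hc : c ≠ 0) (α : ℝ) :
    ∃! z : ℂ, z ^ 12 = c ∧ z ∈ sector α := by
  have hpi := Real.pi_pos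
  have hcn : 0 < ‖c‖ := norm_pos_iff.2 hc
  set ρ : ℝ := ‖c‖ ^ ((12 : ℕ) : ℝ)⁻¹ with hρdef
  have hρ : 0 < ρ := Real.rpow_pos_of_pos hcn _
  have hρ12 : ρ ^ 12 = ‖c‖ := Real.rpow_inv_natCast_pow hcn.le (by norm_num)
  obtain ⟨k, hk, huniq⟩ := existsUnique_add_zsmul_mem_Ico (a := 2 * Real.pi / 12) (by positivity)
    (c.arg / 12) α
  simp only [zsmul_eq_mul, Set.mem_Ico] at hk huniq
  have hpow : ∀ (r θ : ℝ), ((r : ℂ) * Complex.exp ((θ : ℂ) * Complex.I)) ^ 12 =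
      ((r ^ 12 : ℝ) : ℂ) * Complex.exp (((12 * θ : ℝ) : ℂ) * Complex.I) := by
    intro r θ
    rw [mul_pow, ← Complex.exp_nat_mul]
    push_cast
    ring_nf
  refine ⟨(ρ : ℂ) * Complex.exp (((c.arg / 12 + k * (2 * Real.pi / 12) : ℝ) : ℂ) * Complex.I),
    ⟨?_, ρ, _, hρ, hk.1, hk.2, rfl⟩, ?_⟩
  · rw [hpow, hρ12]
    conv_rhs => rw [← Complex.norm_mul_exp_arg_mul_I c]
    congr 1
    rw [Complex.exp_eq_exp_iff_exists_int]
    exact ⟨k, by push_cast; ring⟩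
  · rintro z ⟨hz, r, θ, hr, h1, h2, rfl⟩
    rw [hpow] at hz
    have hn := congrArg norm hz
    rw [norm_mul, Complex.norm_exp_ofReal_mul_I, mul_one, Complex.norm_real,
      Real.norm_of_nonneg (by positivity), ← hρ12] at hn
    have hrρ : r = ρ := (pow_left_inj₀ hr.le hρ.le (by norm_num)).1 hn
    subst hrρ
    rw [hn, hρ12] at hz
    conv_rhs at hz => rw [← Complex.norm_mul_exp_arg_mul_I c]
    have hexp := mul_left_cancel₀ (by exact_mod_cast hcn.ne') hz
    obtain ⟨n, hnn⟩ := Complex.exp_eq_exp_iff_exists_int.1 hexp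
    have h3 : (((12 * θ - c.arg - n * (2 * Real.pi) : ℝ) : ℂ)) * Complex.I = 0 := by
      push_cast at hnn ⊢
      linear_combination hnn
    have h4 : 12 * θ - c.arg - n * (2 * Real.pi) = 0 := by
      exact_mod_cast (mul_eq_zero.1 h3).resolve_right Complex.I_ne_zero
    have h5 : θ = c.arg / 12 + n * (2 * Real.pi / 12) := by linarith
    have h6 : n = k := huniq n ⟨by linarith, by linarith⟩
    rw [h5, h6]

/-- A nonzero complex number has exactly twelve twelfth roots. -/
theorem finite_and_ncard_pow_twelve_eq {c : ℂ} (hc : c ≠ 0) :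
    {z : ℂ | z ^ 12 = c}.Finite ∧ {z : ℂ | z ^ 12 = c}.ncard = 12 := by
  classical
  have hζ := Complex.isPrimitiveRoot_exp 12 (by norm_num)
  have hset : {z : ℂ | z ^ 12 = c} = ((Polynomial.nthRoots 12 c).toFinset : Set ℂ) := by
    ext z
    simp [Polynomial.mem_nthRoots]
  rw [hset]
  refine ⟨Finset.finite_toSet _, ?_⟩
  rw [Set.ncard_coe_finset, Multiset.toFinset_card_of_nodup (hζ.nthRoots_nodup hc),
    hζ.card_nthRoots, if_pos]
  exact IsAlgClosed.exists_pow_nat_eq c (by norm_num)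

/-- Because `z ^ 12 * phase z = |z|¹²`, conditions on modulus and phase merge into one twelfth-power
equation. -/
theorem pow_twelve_eq_iff {t : ℝ} (ht : 0 < t) {c : ℂ} (hc : ‖c‖ = 1) {z : ℂ} :
    z ^ 12 = ((t⁻¹ : ℝ) : ℂ) ^ 6 * conj c ↔ z ≠ 0 ∧ ‖z‖ ^ 2 = t⁻¹ ∧ phase z = c := by
  have hcc : c * conj c = 1 := by rw [Complex.mul_conj', hc]; simp
  have hti : 0 < t⁻¹ := inv_pos.2 ht
  have hti0 : ((t⁻¹ : ℝ) : ℂ) ≠ 0 := by exact_mod_cast hti.ne'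
  have hzp : z ≠ 0 → z ^ 12 * phase z = ((‖z‖ ^ 2 : ℝ) : ℂ) ^ 6 := fun hz => by
    have h : ((‖z‖ ^ 2 : ℝ) : ℂ) = z * conj z := by rw [Complex.mul_conj']; push_cast; rfl
    rw [h, phase]
    field_simp
  constructor
  · intro h
    have hn := congrArg norm h
    rw [norm_mul, Complex.norm_conj, hc, mul_one, norm_pow, norm_pow, Complex.norm_real,
      Real.norm_of_nonneg hti.le] at hn
    have hn2 : ‖z‖ ^ 2 = t⁻¹ := (pow_left_inj₀ (n := 6) (by positivity) hti.le (by norm_num)).1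
      (by rw [← hn]; ring)
    have hz : z ≠ 0 := by
      rintro rfl
      rw [norm_zero] at hn2
      simp at hn2
      linarith
    refine ⟨hz, hn2, ?_⟩
    have h1 := hzp hz
    rw [h, hn2, mul_assoc] at h1
    have h2 := mul_left_cancel₀ (pow_ne_zero 6 hti0) (h1.trans (mul_one _).symm)
    linear_combination c * h2 - phase z * hcc
  · rintro ⟨hz, hn, hp⟩
    have h1 := hzp hz
    rw [hp, hn] at h1
    linear_combination conj c * h1 - z ^ 12 * hcc

/-- The critical points at squared distance `1 / t` from the origin. -/
def criticalRing (p s : ℂ) (t : ℝ) : Set ℂ :=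
  {z | z ^ 12 = ((t⁻¹ : ℝ) : ℂ) ^ 6 * conj (s + t * p)}

theorem critical_equation_iff {p s u : ℂ} {t : ℝ} (ht : 0 < t) :
    p + (t⁻¹ : ℝ) * (s - u) = 0 ↔ u = s + t * p := by
  have ht0 : (t : ℂ) ≠ 0 := by exact_mod_cast ht.ne'
  push_cast
  constructor
  · intro h
    have h1 := congrArg (fun x => (t : ℂ) * x) h
    simp only [mul_add, mul_inv_cancel_left₀ ht0, mul_zero] at h1
    linear_combination -h1
  · rintro rfl
    field_simp
    ring

/-- Here `t = |z|⁻²`; the norm condition expresses that the phase `s + t p` is unimodular. -/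
theorem mem_criticalPoints_iff {p₁ p₂ s₁ s₂ : ℝ} {z : ℂ} :
    z ∈ criticalPoints p₁ p₂ s₁ s₂ ↔ z = 0 ∨ ∃ t : ℝ, 0 < t ∧
      ‖(⟨s₁, s₂⟩ : ℂ) + t * (⟨p₁, p₂⟩ : ℂ)‖ = 1 ∧ z ∈ criticalRing ⟨p₁, p₂⟩ ⟨s₁, s₂⟩ t := by
  rcases eq_or_ne z 0 with rfl | hz
  · simp [criticalPoints, planarField_zero]
  simp only [hz, false_or, criticalPoints, criticalRing, Set.mem_ofPred_eq,
    planarField_eq_mul _ _ _ _ hz, mul_eq_zero]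
  have hr : 0 < ‖z‖ ^ 2 := by positivity
  constructor
  · intro h
    have hri : ‖z‖ ^ 2 = ((‖z‖ ^ 2)⁻¹)⁻¹ := (inv_inv _).symm
    rw [hri, critical_equation_iff (inv_pos.2 hr)] at h
    have hn := norm_phase hz
    rw [h] at hn
    exact ⟨_, inv_pos.2 hr, hn, (pow_twelve_eq_iff (inv_pos.2 hr) hn).2 ⟨hz, hri, h⟩⟩
  · rintro ⟨t, ht, hn, h⟩
    obtain ⟨-, h1, h2⟩ := (pow_twelve_eq_iff ht hn).1 h
    rw [h1, critical_equation_iff ht]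
    exact h2

theorem norm_add_mul_eq_one_iff {p₁ p₂ s₁ s₂ t : ℝ} :
    ‖(⟨s₁, s₂⟩ : ℂ) + t * (⟨p₁, p₂⟩ : ℂ)‖ = 1 ↔ (s₁ + t * p₁) ^ 2 + (s₂ + t * p₂) ^ 2 = 1 := by
  rw [← sq_eq_sq₀ (norm_nonneg _) zero_le_one, ← Complex.normSq_eq_norm_sq, Complex.normSq_apply]
  simp [sq]

/-! ### Local type of the points on a ring. -/

section Ring

variable {p₁ p₂ s₁ s₂ t : ℝ} {z : ℂ}

theorem criticalRing_ne_zero (ht : 0 < t) (hn : ‖(⟨s₁, s₂⟩ : ℂ) + t * (⟨p₁, p₂⟩ : ℂ)‖ = 1) :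
    ((t⁻¹ : ℝ) : ℂ) ^ 6 * conj ((⟨s₁, s₂⟩ : ℂ) + t * (⟨p₁, p₂⟩ : ℂ)) ≠ 0 := by
  refine mul_ne_zero (pow_ne_zero _ (by exact_mod_cast (inv_pos.2 ht).ne')) ?_
  rw [← norm_ne_zero_iff, Complex.norm_conj, hn]
  exact one_ne_zero

theorem criticalRing_spec (ht : 0 < t) (hn : ‖(⟨s₁, s₂⟩ : ℂ) + t * (⟨p₁, p₂⟩ : ℂ)‖ = 1)
    (hz : z ∈ criticalRing ⟨p₁, p₂⟩ ⟨s₁, s₂⟩ t) :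
    z ≠ 0 ∧ ‖z‖ ^ 2 = t⁻¹ ∧ phase z = (⟨s₁, s₂⟩ : ℂ) + t * (⟨p₁, p₂⟩ : ℂ) ∧
      (⟨p₁, p₂⟩ : ℂ) + (‖z‖ ^ 2 : ℝ) * ((⟨s₁, s₂⟩ : ℂ) - phase z) = 0 := by
  obtain ⟨h0, h1, h2⟩ := (pow_twelve_eq_iff ht hn).1 hz
  refine ⟨h0, h1, h2, ?_⟩
  rw [h1, critical_equation_iff ht]
  exact h2

/-- The bracket is half the `t`-derivative of `|s + t p|²`, so the sign of the Jacobian determinant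
tells whether the ray enters or leaves the unit disc. -/
theorem re_mul_conj_phase (ht : 0 < t) (hn : ‖(⟨s₁, s₂⟩ : ℂ) + t * (⟨p₁, p₂⟩ : ℂ)‖ = 1)
    (hz : z ∈ criticalRing ⟨p₁, p₂⟩ ⟨s₁, s₂⟩ t) :
    ((⟨s₁, s₂⟩ : ℂ) * conj (phase z)).re - 1 =
      -(t * ((p₁ ^ 2 + p₂ ^ 2) * t + (p₁ * s₁ + p₂ * s₂))) := by
  rw [(criticalRing_spec ht hn hz).2.2.1]
  rw [norm_add_mul_eq_one_iff] at hn
  simp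
  linear_combination hn

theorem planarField_eq_zero_of_mem_ring (ht : 0 < t)
    (hn : ‖(⟨s₁, s₂⟩ : ℂ) + t * (⟨p₁, p₂⟩ : ℂ)‖ = 1)
    (hz : z ∈ criticalRing ⟨p₁, p₂⟩ ⟨s₁, s₂⟩ t) : planarField p₁ p₂ s₁ s₂ z = 0 :=
  mem_criticalPoints_iff.2 (Or.inr ⟨t, ht, hn, hz⟩)

/-- The critical points on the outer ring have index `1` and are not saddles. -/
theorem hasPoincareIndex_one_of_mem_ring (ht : 0 < t)
    (hn : ‖(⟨s₁, s₂⟩ : ℂ) + t * (⟨p₁, p₂⟩ : ℂ)‖ = 1)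
    (hneg : (p₁ ^ 2 + p₂ ^ 2) * t + (p₁ * s₁ + p₂ * s₂) < 0)
    (hz : z ∈ criticalRing ⟨p₁, p₂⟩ ⟨s₁, s₂⟩ t) :
    HasPoincareIndex (planarField p₁ p₂ s₁ s₂) z 1 ∧ ¬ IsSaddle (planarField p₁ p₂ s₁ s₂) z := by
  obtain ⟨hz0, -, -, hc⟩ := criticalRing_spec ht hn hz
  have hV := planarField_eq_zero_of_mem_ring ht hn hz
  have hd := hasFDerivAt_planarField_of_critical hz0 hc
  have hdet := jacobian_det_of_critical ⟨s₁, s₂⟩ hz0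
  rw [re_mul_conj_phase ht hn hz] at hdet
  have hpos : 0 < 24 * ‖z‖ ^ 4 * -(t * ((p₁ ^ 2 + p₂ ^ 2) * t + (p₁ * s₁ + p₂ * s₂))) :=
    mul_pos (by positivity) (by nlinarith)
  have hlt := lt_of_pow_lt_pow_left₀ 2 (norm_nonneg _) (sub_pos.1 (hdet ▸ hpos))
  refine ⟨hasPoincareIndex_one hV (eventually_continuousAt_planarField _ _ _ _ hz0) hd hlt, ?_⟩
  rw [isSaddle_iff hV hd]
  exact hlt.not_gt

/-- The critical points on the inner ring are saddles and do not have index `1`. -/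
theorem isSaddle_of_mem_ring (ht : 0 < t) (hn : ‖(⟨s₁, s₂⟩ : ℂ) + t * (⟨p₁, p₂⟩ : ℂ)‖ = 1)
    (hpos : 0 < (p₁ ^ 2 + p₂ ^ 2) * t + (p₁ * s₁ + p₂ * s₂))
    (hz : z ∈ criticalRing ⟨p₁, p₂⟩ ⟨s₁, s₂⟩ t) :
    IsSaddle (planarField p₁ p₂ s₁ s₂) z ∧
      ¬ HasPoincareIndex (planarField p₁ p₂ s₁ s₂) z 1 := by
  obtain ⟨hz0, -, -, hc⟩ := criticalRing_spec ht hn hz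
  have hV := planarField_eq_zero_of_mem_ring ht hn hz
  have hd := hasFDerivAt_planarField_of_critical hz0 hc
  have hdet := jacobian_det_of_critical ⟨s₁, s₂⟩ hz0
  rw [re_mul_conj_phase ht hn hz] at hdet
  have hneg : 24 * ‖z‖ ^ 4 * -(t * ((p₁ ^ 2 + p₂ ^ 2) * t + (p₁ * s₁ + p₂ * s₂))) < 0 :=
    mul_neg_of_pos_of_neg (by positivity) (neg_neg_of_pos (mul_pos ht hpos))
  have hlt := lt_of_pow_lt_pow_left₀ 2 (norm_nonneg _) (sub_neg.1 (hdet ▸ hneg))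
  refine ⟨(isSaddle_iff hV hd).2 hlt, fun h => ?_⟩
  have := h.unique
    (hasPoincareIndex_neg_one hV (eventually_continuousAt_planarField _ _ _ _ hz0) hd hlt)
  norm_num at this

/-- The critical points on a double ring. -/
theorem degenerate_of_mem_ring (ht : 0 < t) (hn : ‖(⟨s₁, s₂⟩ : ℂ) + t * (⟨p₁, p₂⟩ : ℂ)‖ = 1)
    (hs : 1 < s₂ ^ 2) (hp : 0 < p₁ ^ 2 + p₂ ^ 2)
    (hzero : (p₁ ^ 2 + p₂ ^ 2) * t + (p₁ * s₁ + p₂ * s₂) = 0)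
    (hfin : (criticalPoints p₁ p₂ s₁ s₂).Finite)
    (hz : z ∈ criticalRing ⟨p₁, p₂⟩ ⟨s₁, s₂⟩ t) :
    IsJacobianEigenvalue (planarField p₁ p₂ s₁ s₂) z 0 ∧
      HasPoincareIndex (planarField p₁ p₂ s₁ s₂) z 0 ∧
      (IsSaddleNode (planarField p₁ p₂ s₁ s₂) z ↔
        p₁ ^ 2 * s₁ + 6 * p₂ ^ 2 * s₁ - 5 * p₁ * p₂ * s₂ ≠ 0) := by
  obtain ⟨hz0, -, hu, hc⟩ := criticalRing_spec ht hn hz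
  have hd := hasFDerivAt_planarField_of_critical hz0 hc
  have hdet := jacobian_det_of_critical ⟨s₁, s₂⟩ hz0
  have hre := re_mul_conj_phase ht hn hz
  rw [hzero, mul_zero, neg_zero, sub_eq_zero] at hre
  rw [hre, sub_self, mul_zero] at hdet
  have hn' := norm_add_mul_eq_one_iff.1 hn
  refine ⟨?_, hasPoincareIndex_zero_of_critical hz0 hc hre ?_, ?_⟩
  · rw [isJacobianEigenvalue_iff hd, hdet]
    ring
  -- Finiteness of the critical set makes `z` isolated.
  · have h1 : (criticalPoints p₁ p₂ s₁ s₂ \ {z})ᶜ ∈ 𝓝 z :=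
      (hfin.subset Set.sdiff_subset).isClosed.isOpen_compl.mem_nhds (by simp)
    rw [eventually_nhdsWithin_iff]
    filter_upwards [h1] with w hw hwz h0
    exact hw ⟨h0, hwz⟩
  -- Otherwise `s ū = 1` and `|s| = 1`, contrary to `s₂² > 1`.
  · have him : ((⟨s₁, s₂⟩ : ℂ) * conj (phase z)).im ≠ 0 := by
      intro him
      have h1 : ((⟨s₁, s₂⟩ : ℂ) * conj (phase z)) = 1 := Complex.ext hre him
      have h2 := congrArg norm h1
      rw [norm_mul, Complex.norm_conj, norm_phase hz0, mul_one, norm_one] at h2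
      have h3 : s₁ ^ 2 + s₂ ^ 2 = 1 := by
        have := Complex.sq_norm (⟨s₁, s₂⟩ : ℂ)
        rw [h2, Complex.normSq_mk] at this
        linarith
      nlinarith [sq_nonneg s₁]
    rw [isSaddleNode_iff_of_critical hz0 hc hre him, hu]
    have h5 : p₁ ^ 2 * s₁ + 6 * p₂ ^ 2 * s₁ - 5 * p₁ * p₂ * s₂ =
        (p₁ ^ 2 + p₂ ^ 2) * (s₁ + 5 * (s₁ + t * p₁)) := by
      linear_combination (-5 * p₁) * hzero
    have h6 : ((⟨s₁, s₂⟩ : ℂ) + t * (⟨p₁, p₂⟩ : ℂ)).re = s₁ + t * p₁ := by simp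
    rw [h5, h6, mul_ne_zero_iff]
    exact ⟨fun h => ⟨hp.ne', h⟩, fun h => h.2⟩

end Ring

/-! ### Intersections of the ray with the circle, and counting. -/

section Count

variable {p₁ p₂ s₁ s₂ t t' : ℝ}

theorem criticalPoints_eq_singleton
    (h : ∀ t : ℝ, 0 < t → (s₁ + t * p₁) ^ 2 + (s₂ + t * p₂) ^ 2 ≠ 1) :
    criticalPoints p₁ p₂ s₁ s₂ = {0} := by
  ext z
  rw [mem_criticalPoints_iff, Set.mem_singleton_iff, or_iff_left]
  rintro ⟨t, ht, hn, -⟩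
  exact h t ht (norm_add_mul_eq_one_iff.1 hn)

/-- Completes the square in `t`. -/
theorem quadForm_eq (p₁ p₂ s₁ s₂ t : ℝ) :
    (p₁ ^ 2 + p₂ ^ 2) * ((s₁ + t * p₁) ^ 2 + (s₂ + t * p₂) ^ 2 - 1) =
      ((p₁ ^ 2 + p₂ ^ 2) * t + (p₁ * s₁ + p₂ * s₂)) ^ 2 - quadForm s₁ s₂ p₁ p₂ := by
  rw [quadForm]
  ring

theorem norm_eq_one_iff_quadForm (hp : 0 < p₁ ^ 2 + p₂ ^ 2) :
    ‖(⟨s₁, s₂⟩ : ℂ) + t * (⟨p₁, p₂⟩ : ℂ)‖ = 1 ↔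
      ((p₁ ^ 2 + p₂ ^ 2) * t + (p₁ * s₁ + p₂ * s₂)) ^ 2 = quadForm s₁ s₂ p₁ p₂ := by
  rw [norm_add_mul_eq_one_iff, ← sub_eq_zero, ← sub_eq_zero (b := quadForm _ _ _ _), ← quadForm_eq,
    mul_eq_zero, or_iff_right hp.ne']

/-- The point of the line `s + t p` nearest to the origin has `t = -(p·s)/|p|²`. If this were `≤ 0`,
then `t p₂` would not oppose `s₂`, so that point would have ordinate of modulus above `1` and the
line would miss the disc, forcing `Q < 0`. -/
theorem inner_neg_of_quadForm_nonneg (hs : 1 < s₂ ^ 2) (hps : p₂ * s₂ < 0)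
    (hQ : 0 ≤ quadForm s₁ s₂ p₁ p₂) : p₁ * s₁ + p₂ * s₂ < 0 := by
  rw [quadForm] at hQ
  by_contra! h
  have hp2 : 0 < p₂ ^ 2 := by
    have : p₂ ≠ 0 := by rintro rfl; simp at hps
    positivity
  have h1 : 0 ≤ -(p₂ * s₂) * (p₁ * s₁ + p₂ * s₂) := mul_nonneg (by linarith) h
  have h2 : 0 ≤ p₁ ^ 2 * (s₂ ^ 2 - 1) := mul_nonneg (sq_nonneg _) (by linarith)
  have h3 : 0 < p₂ ^ 2 * (s₂ ^ 2 - 1) := mul_pos hp2 (by linarith)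
  nlinarith [mul_nonneg (sq_nonneg p₂) (sq_nonneg s₁)]

theorem finite_criticalRing (ht : 0 < t) (hn : ‖(⟨s₁, s₂⟩ : ℂ) + t * (⟨p₁, p₂⟩ : ℂ)‖ = 1) :
    (criticalRing ⟨p₁, p₂⟩ ⟨s₁, s₂⟩ t).Finite :=
  (finite_and_ncard_pow_twelve_eq (criticalRing_ne_zero ht hn)).1

theorem ncard_criticalRing (ht : 0 < t) (hn : ‖(⟨s₁, s₂⟩ : ℂ) + t * (⟨p₁, p₂⟩ : ℂ)‖ = 1) :
    (criticalRing ⟨p₁, p₂⟩ ⟨s₁, s₂⟩ t).ncard = 12 :=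
  (finite_and_ncard_pow_twelve_eq (criticalRing_ne_zero ht hn)).2

theorem existsUnique_mem_criticalRing_mem_sector (ht : 0 < t)
    (hn : ‖(⟨s₁, s₂⟩ : ℂ) + t * (⟨p₁, p₂⟩ : ℂ)‖ = 1) (α : ℝ) :
    ∃! z, z ∈ criticalRing ⟨p₁, p₂⟩ ⟨s₁, s₂⟩ t ∧ z ∈ sector α :=
  existsUnique_pow_twelve_eq_mem_sector (criticalRing_ne_zero ht hn) α

theorem ne_zero_of_mem_sector {z : ℂ} {α : ℝ} (hz : z ∈ sector α) : z ≠ 0 := by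
  obtain ⟨ρ, θ, hρ, -, -, rfl⟩ := hz
  exact mul_ne_zero (by exact_mod_cast hρ.ne') (Complex.exp_ne_zero _)

theorem disjoint_criticalRing (ht : 0 < t) (hn : ‖(⟨s₁, s₂⟩ : ℂ) + t * (⟨p₁, p₂⟩ : ℂ)‖ = 1)
    (ht' : 0 < t') (hn' : ‖(⟨s₁, s₂⟩ : ℂ) + t' * (⟨p₁, p₂⟩ : ℂ)‖ = 1) (hne : t ≠ t') :
    Disjoint (criticalRing ⟨p₁, p₂⟩ ⟨s₁, s₂⟩ t) (criticalRing ⟨p₁, p₂⟩ ⟨s₁, s₂⟩ t') := by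
  rw [Set.disjoint_left]
  intro z hz hz'
  have h := (criticalRing_spec ht hn hz).2.1.symm.trans (criticalRing_spec ht' hn' hz').2.1
  exact hne (inv_injective h)

theorem degenerate_case (hs : 1 < s₂ ^ 2) (hps : p₂ * s₂ < 0) (hQ : quadForm s₁ s₂ p₁ p₂ = 0) :
    0 ∈ criticalPoints p₁ p₂ s₁ s₂ ∧
      (criticalPoints p₁ p₂ s₁ s₂).ncard = 13 ∧
      (∀ α : ℝ, ∃! z : ℂ, z ∈ criticalPoints p₁ p₂ s₁ s₂ ∧ z ∈ sector α) ∧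
      ∀ z ∈ criticalPoints p₁ p₂ s₁ s₂, z ≠ 0 →
        IsJacobianEigenvalue (planarField p₁ p₂ s₁ s₂) z 0 ∧
        HasPoincareIndex (planarField p₁ p₂ s₁ s₂) z 0 ∧
        (IsSaddleNode (planarField p₁ p₂ s₁ s₂) z ↔
          p₁ ^ 2 * s₁ + 6 * p₂ ^ 2 * s₁ - 5 * p₁ * p₂ * s₂ ≠ 0) := by
  have hb := inner_neg_of_quadForm_nonneg hs hps hQ.ge
  have hp : 0 < p₁ ^ 2 + p₂ ^ 2 := by
    have : p₂ ≠ 0 := by rintro rfl; simp at hps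
    positivity
  obtain ⟨t, ht⟩ : ∃ t, t = -(p₁ * s₁ + p₂ * s₂) / (p₁ ^ 2 + p₂ ^ 2) := ⟨_, rfl⟩
  have hzero : (p₁ ^ 2 + p₂ ^ 2) * t + (p₁ * s₁ + p₂ * s₂) = 0 := by
    rw [ht, mul_div_cancel₀ _ hp.ne']; ring
  have ht0 : 0 < t := ht ▸ div_pos (by linarith) hp
  have hn : ‖(⟨s₁, s₂⟩ : ℂ) + t * (⟨p₁, p₂⟩ : ℂ)‖ = 1 := by
    rw [norm_eq_one_iff_quadForm hp, hzero, hQ]; ring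
  have hset : criticalPoints p₁ p₂ s₁ s₂ = insert 0 (criticalRing ⟨p₁, p₂⟩ ⟨s₁, s₂⟩ t) := by
    ext z
    rw [mem_criticalPoints_iff, Set.mem_insert_iff]
    refine or_congr_right ⟨?_, fun h => ⟨t, ht0, hn, h⟩⟩
    rintro ⟨t', -, hn', h⟩
    rw [norm_eq_one_iff_quadForm hp, hQ, sq_eq_zero_iff] at hn'
    have : t' = t := mul_left_cancel₀ hp.ne' (by linarith)
    rwa [this] at h
  have hfin := finite_criticalRing ht0 hn
  have h0 : (0 : ℂ) ∉ criticalRing ⟨p₁, p₂⟩ ⟨s₁, s₂⟩ t := fun h =>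
    (criticalRing_spec ht0 hn h).1 rfl
  have hfin' : (criticalPoints p₁ p₂ s₁ s₂).Finite := hset ▸ hfin.insert 0
  refine ⟨by simp [hset], ?_, fun α => ?_, fun z hz hz0 => ?_⟩
  · rw [hset, Set.ncard_insert_of_notMem h0 hfin, ncard_criticalRing ht0 hn]
  · refine (existsUnique_congr fun z => ?_).1 (existsUnique_mem_criticalRing_mem_sector ht0 hn α)
    refine and_congr_left fun hz => ?_
    rw [hset, Set.mem_insert_iff, or_iff_right (ne_zero_of_mem_sector hz)]
  · rw [hset, Set.mem_insert_iff, or_iff_right hz0] at hz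
    exact degenerate_of_mem_ring ht0 hn hs hp hzero hfin' hz

theorem hyperbolic_case (hs : 1 < s₂ ^ 2) (hps : p₂ * s₂ < 0) (hQ : 0 < quadForm s₁ s₂ p₁ p₂) :
    0 ∈ criticalPoints p₁ p₂ s₁ s₂ ∧
      (criticalPoints p₁ p₂ s₁ s₂).ncard = 25 ∧
      {z | z ∈ criticalPoints p₁ p₂ s₁ s₂ ∧ z ≠ 0 ∧
        IsSaddle (planarField p₁ p₂ s₁ s₂) z}.ncard = 12 ∧
      {z | z ∈ criticalPoints p₁ p₂ s₁ s₂ ∧ z ≠ 0 ∧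
        HasPoincareIndex (planarField p₁ p₂ s₁ s₂) z 1}.ncard = 12 ∧
      (∀ z ∈ criticalPoints p₁ p₂ s₁ s₂, z ≠ 0 →
        IsSaddle (planarField p₁ p₂ s₁ s₂) z ∨
        HasPoincareIndex (planarField p₁ p₂ s₁ s₂) z 1) ∧
      ∀ α : ℝ,
        (∃! z : ℂ, z ∈ criticalPoints p₁ p₂ s₁ s₂ ∧ z ∈ sector α ∧
          IsSaddle (planarField p₁ p₂ s₁ s₂) z) ∧
        (∃! z : ℂ, z ∈ criticalPoints p₁ p₂ s₁ s₂ ∧ z ∈ sector α ∧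
          HasPoincareIndex (planarField p₁ p₂ s₁ s₂) z 1) := by
  have hb := inner_neg_of_quadForm_nonneg hs hps hQ.le
  have hp : 0 < p₁ ^ 2 + p₂ ^ 2 := by
    have : p₂ ≠ 0 := by rintro rfl; simp at hps
    positivity
  obtain ⟨q, hq, hqQ⟩ : ∃ q, 0 < q ∧ q ^ 2 = quadForm s₁ s₂ p₁ p₂ :=
    ⟨_, Real.sqrt_pos.2 hQ, Real.sq_sqrt hQ.le⟩
  -- Both roots are positive: at `t = 0` the completed square gives `(p·s)² - Q = |p|² (|s|² - 1) >
  -- 0`.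
  have hqb : q < -(p₁ * s₁ + p₂ * s₂) := by
    refine lt_of_pow_lt_pow_left₀ 2 (by linarith) ?_
    have h1 := quadForm_eq p₁ p₂ s₁ s₂ 0
    have h2 : 0 < (p₁ ^ 2 + p₂ ^ 2) * (s₁ ^ 2 + s₂ ^ 2 - 1) :=
      mul_pos hp (by nlinarith [sq_nonneg s₁])
    rw [hqQ]
    nlinarith
  -- The smaller root `t` is the entry point and the outer ring, since `|z|² = 1 / t`; `t'` is the
  -- exit point and the inner ring.
  obtain ⟨t, ht⟩ : ∃ t, t = (-(p₁ * s₁ + p₂ * s₂) - q) / (p₁ ^ 2 + p₂ ^ 2) := ⟨_, rfl⟩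
  obtain ⟨t', ht'⟩ : ∃ t, t = (-(p₁ * s₁ + p₂ * s₂) + q) / (p₁ ^ 2 + p₂ ^ 2) := ⟨_, rfl⟩
  have hlin : (p₁ ^ 2 + p₂ ^ 2) * t + (p₁ * s₁ + p₂ * s₂) = -q := by
    rw [ht, mul_div_cancel₀ _ hp.ne']; ring
  have hlin' : (p₁ ^ 2 + p₂ ^ 2) * t' + (p₁ * s₁ + p₂ * s₂) = q := by
    rw [ht', mul_div_cancel₀ _ hp.ne']; ring
  have ht0 : 0 < t := ht ▸ div_pos (by linarith) hp
  have ht0' : 0 < t' := ht' ▸ div_pos (by linarith) hp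
  have hn : ‖(⟨s₁, s₂⟩ : ℂ) + t * (⟨p₁, p₂⟩ : ℂ)‖ = 1 := by
    rw [norm_eq_one_iff_quadForm hp, hlin, ← hqQ]; ring
  have hn' : ‖(⟨s₁, s₂⟩ : ℂ) + t' * (⟨p₁, p₂⟩ : ℂ)‖ = 1 := by
    rw [norm_eq_one_iff_quadForm hp, hlin', ← hqQ]
  have hne : t ≠ t' := by rintro rfl; linarith
  set R := criticalRing ⟨p₁, p₂⟩ ⟨s₁, s₂⟩ t
  set R' := criticalRing ⟨p₁, p₂⟩ ⟨s₁, s₂⟩ t'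
  have hmem : ∀ z, z ∈ criticalPoints p₁ p₂ s₁ s₂ ↔ z = 0 ∨ z ∈ R ∨ z ∈ R' := by
    intro z
    rw [mem_criticalPoints_iff]
    refine or_congr_right ⟨?_, ?_⟩
    · rintro ⟨x, -, hnx, h⟩
      rw [norm_eq_one_iff_quadForm hp, ← hqQ, sq_eq_sq_iff_eq_or_eq_neg] at hnx
      rcases hnx with hx | hx
      · have : x = t' := mul_left_cancel₀ hp.ne' (by linarith)
        rw [this] at h
        exact Or.inr h
      · have : x = t := mul_left_cancel₀ hp.ne' (by linarith)
        rw [this] at h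
        exact Or.inl h
    · rintro (h | h)
      · exact ⟨t, ht0, hn, h⟩
      · exact ⟨t', ht0', hn', h⟩
  have hR0 : ∀ z ∈ R, z ≠ 0 := fun z hz => (criticalRing_spec ht0 hn hz).1
  have hR0' : ∀ z ∈ R', z ≠ 0 := fun z hz => (criticalRing_spec ht0' hn' hz).1
  have hR : ∀ z ∈ R, HasPoincareIndex (planarField p₁ p₂ s₁ s₂) z 1 ∧
      ¬ IsSaddle (planarField p₁ p₂ s₁ s₂) z := fun z hz =>
    hasPoincareIndex_one_of_mem_ring ht0 hn (by linarith) hz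
  have hR' : ∀ z ∈ R', IsSaddle (planarField p₁ p₂ s₁ s₂) z ∧
      ¬ HasPoincareIndex (planarField p₁ p₂ s₁ s₂) z 1 := fun z hz =>
    isSaddle_of_mem_ring ht0' hn' (by linarith) hz
  have hsad : ∀ z, z ∈ criticalPoints p₁ p₂ s₁ s₂ ∧ z ≠ 0 ∧
      IsSaddle (planarField p₁ p₂ s₁ s₂) z ↔ z ∈ R' := by
    intro z
    rw [hmem]
    constructor
    · rintro ⟨h | h | h, hz, hsd⟩
      · exact absurd h hz
      · exact absurd hsd (hR z h).2
      · exact h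
    · exact fun h => ⟨Or.inr (Or.inr h), hR0' z h, (hR' z h).1⟩
  have hidx : ∀ z, z ∈ criticalPoints p₁ p₂ s₁ s₂ ∧ z ≠ 0 ∧
      HasPoincareIndex (planarField p₁ p₂ s₁ s₂) z 1 ↔ z ∈ R := by
    intro z
    rw [hmem]
    constructor
    · rintro ⟨h | h | h, hz, hi⟩
      · exact absurd h hz
      · exact h
      · exact absurd hi (hR' z h).2
    · exact fun h => ⟨Or.inr (Or.inl h), hR0 z h, (hR z h).1⟩
  have hfin : R.Finite := finite_criticalRing ht0 hn
  have hfin' : R'.Finite := finite_criticalRing ht0' hn'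
  refine ⟨(hmem 0).2 (Or.inl rfl), ?_, ?_, ?_, fun z hz hz0 => ?_, fun α => ⟨?_, ?_⟩⟩
  · have hset : criticalPoints p₁ p₂ s₁ s₂ = insert 0 (R ∪ R') := by
      ext z
      rw [hmem, Set.mem_insert_iff, Set.mem_union]
    rw [hset, Set.ncard_insert_of_notMem ?_ (hfin.union hfin'),
      Set.ncard_union_eq (disjoint_criticalRing ht0 hn ht0' hn' hne) hfin hfin',
      ncard_criticalRing ht0 hn, ncard_criticalRing ht0' hn']
    rintro (h | h)
    · exact hR0 0 h rfl
    · exact hR0' 0 h rfl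
  · simp only [hsad]
    exact ncard_criticalRing ht0' hn'
  · simp only [hidx]
    exact ncard_criticalRing ht0 hn
  · rcases (hmem z).1 hz with h | h | h
    · exact absurd h hz0
    · exact Or.inr (hR z h).1
    · exact Or.inl (hR' z h).1
  · refine (existsUnique_congr fun z => ?_).1
      (existsUnique_mem_criticalRing_mem_sector ht0' hn' α)
    rw [← hsad]
    have := ne_zero_of_mem_sector (z := z) (α := α)
    tauto
  · refine (existsUnique_congr fun z => ?_).1
      (existsUnique_mem_criticalRing_mem_sector ht0 hn α)
    rw [← hidx]
    have := ne_zero_of_mem_sector (z := z) (α := α)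
    tauto

end Count

theorem lemma3p4 (p₁ p₂ s₁ s₂ : ℝ) :
    quadForm s₁ s₂ p₁ p₂ =
      (1 - s₂ ^ 2) * p₁ ^ 2 + (1 - s₁ ^ 2) * p₂ ^ 2 + 2 * s₁ * s₂ * p₁ * p₂ ∧
    ((1 < s₂ ∧ 0 ≤ p₂) ∨ (s₂ < -1 ∧ p₂ ≤ 0) → criticalPoints p₁ p₂ s₁ s₂ = {0}) ∧
    ((1 < s₂ ∧ p₂ < 0) ∨ (s₂ < -1 ∧ 0 < p₂) →
      (quadForm s₁ s₂ p₁ p₂ < 0 → criticalPoints p₁ p₂ s₁ s₂ = {0}) ∧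
      (quadForm s₁ s₂ p₁ p₂ = 0 →
        0 ∈ criticalPoints p₁ p₂ s₁ s₂ ∧
        (criticalPoints p₁ p₂ s₁ s₂).ncard = 13 ∧
        (∀ α : ℝ, ∃! z : ℂ, z ∈ criticalPoints p₁ p₂ s₁ s₂ ∧ z ∈ sector α) ∧
        ∀ z ∈ criticalPoints p₁ p₂ s₁ s₂, z ≠ 0 →
          IsJacobianEigenvalue (planarField p₁ p₂ s₁ s₂) z 0 ∧
          HasPoincareIndex (planarField p₁ p₂ s₁ s₂) z 0 ∧
          (IsSaddleNode (planarField p₁ p₂ s₁ s₂) z ↔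
            p₁ ^ 2 * s₁ + 6 * p₂ ^ 2 * s₁ - 5 * p₁ * p₂ * s₂ ≠ 0)) ∧
      (0 < quadForm s₁ s₂ p₁ p₂ →
        0 ∈ criticalPoints p₁ p₂ s₁ s₂ ∧
        (criticalPoints p₁ p₂ s₁ s₂).ncard = 25 ∧
        {z | z ∈ criticalPoints p₁ p₂ s₁ s₂ ∧ z ≠ 0 ∧
          IsSaddle (planarField p₁ p₂ s₁ s₂) z}.ncard = 12 ∧
        {z | z ∈ criticalPoints p₁ p₂ s₁ s₂ ∧ z ≠ 0 ∧
          HasPoincareIndex (planarField p₁ p₂ s₁ s₂) z 1}.ncard = 12 ∧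
        (∀ z ∈ criticalPoints p₁ p₂ s₁ s₂, z ≠ 0 →
          IsSaddle (planarField p₁ p₂ s₁ s₂) z ∨
          HasPoincareIndex (planarField p₁ p₂ s₁ s₂) z 1) ∧
        ∀ α : ℝ,
          (∃! z : ℂ, z ∈ criticalPoints p₁ p₂ s₁ s₂ ∧ z ∈ sector α ∧
            IsSaddle (planarField p₁ p₂ s₁ s₂) z) ∧
          (∃! z : ℂ, z ∈ criticalPoints p₁ p₂ s₁ s₂ ∧ z ∈ sector α ∧
            HasPoincareIndex (planarField p₁ p₂ s₁ s₂) z 1))) := by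
  refine ⟨by rw [quadForm]; ring, fun h => ?_, fun h => ?_⟩
  · refine criticalPoints_eq_singleton fun t ht hn => ?_
    -- The ordinate `s₂ + t p₂` keeps modulus above `1`, so the ray never meets the circle.
    rcases h with ⟨hs, hp⟩ | ⟨hs, hp⟩
    · nlinarith [mul_nonneg ht.le hp, sq_nonneg (s₁ + t * p₁)]
    · nlinarith [mul_nonneg ht.le (neg_nonneg.2 hp), sq_nonneg (s₁ + t * p₁)]
  -- The two sign cases enter the rest only through `s₂² > 1` and `p₂ s₂ < 0`.
  · have hs : 1 < s₂ ^ 2 := by rcases h with ⟨hs, -⟩ | ⟨hs, -⟩ <;> nlinarith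
    have hps : p₂ * s₂ < 0 := by rcases h with ⟨hs, hp⟩ | ⟨hs, hp⟩ <;> nlinarith
    refine ⟨fun hQ => criticalPoints_eq_singleton fun t _ hn => ?_, degenerate_case hs hps,
      hyperbolic_case hs hps⟩
    have h1 := quadForm_eq p₁ p₂ s₁ s₂ t
    rw [hn, sub_self, mul_zero] at h1
    nlinarith [sq_nonneg ((p₁ ^ 2 + p₂ ^ 2) * t + (p₁ * s₁ + p₂ * s₂))]
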